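/- Let $n\ge 1$ and let $\Omega\subset\mathbb R^n$ be a nonempty open set. Let $f=(f^1,\dots,f^n):\Omega\to\mathbb R^n$ be a (pointwise defined) map in the Sobolev space $W^{1,n}(\Omega;\mathbb R^n)$, that is, every component $f^i$ belongs to $L^n(\Omega)$ and has weak partial derivatives $\partial f^i/\partial x_1,\dots,\partial f^i/\partial x_n\in L^n(\Omega)$. Let $J_f=\det\big(\partial f^i/\partial x_j\big)_{i,j}$ be its Jacobian, formed with the weak partial derivatives. Suppose that $f$ has property (N): for every $E\subset\Omega$ with $\mathcal L^n(E)=0$ one has $\mathcal L^n(f(E))=0$. For $y\in\mathbb R^n$ let $N(f,\Omega,y)\in\{0,1,2,\dots\}\cup\{+\infty\}$ be the number of points $x\in\Omega$ with $f(x)=y$. Then $J_f\in L^1(\Omega)$, the function $y\mapsto N(f,\Omega,y)$ is Lebesgue measurable on $\mathbb R^n$, and $$\int_\Omega |J_f|\,d\mathcal L^n=\int_{\mathbb R^n}N(f,\Omega,y)\,dy .$$ -/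

import Mathlib

open MeasureTheory
open scoped ENNReal ContDiff

namespace SobolevArea

/-- `g` is a weak partial derivative of `u` on `Ω` in the `j`-th coordinate direction:
`u` and `g` are locally integrable on `Ω` and `∫_Ω φ g = - ∫_Ω (∂φ/∂x_j) u` for every
real-valued `φ` of class `C_c^∞(Ω)`. -/
def IsWeakPartial {n : ℕ} (Ω : Set (EuclideanSpace ℝ (Fin n)))
    (u : EuclideanSpace ℝ (Fin n) → ℝ) (j : Fin n)
    (g : EuclideanSpace ℝ (Fin n) → ℝ) : Prop :=
  LocallyIntegrableOn u Ω volume ∧ LocallyIntegrableOn g Ω volume ∧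
    ∀ φ : EuclideanSpace ℝ (Fin n) → ℝ,
      ContDiff ℝ ∞ φ → HasCompactSupport φ → tsupport φ ⊆ Ω →
        ∫ x in Ω, φ x * g x =
          - ∫ x in Ω, fderiv ℝ φ x (EuclideanSpace.single j (1 : ℝ)) * u x

/-- Scalar Sobolev functions: `u ∈ W^{1,p}(Ω)`. -/
def MemW1 {n : ℕ} (Ω : Set (EuclideanSpace ℝ (Fin n))) (p : ℝ≥0∞)
    (u : EuclideanSpace ℝ (Fin n) → ℝ) : Prop :=
  MemLp u p (volume.restrict Ω) ∧
    ∀ j : Fin n, ∃ g : EuclideanSpace ℝ (Fin n) → ℝ,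
      IsWeakPartial Ω u j g ∧ MemLp g p (volume.restrict Ω)

/-- Vector-valued Sobolev maps: `f ∈ W^{1,p}(Ω; ℝⁿ)`, that is, every component of `f` is in
`W^{1,p}(Ω)`. -/
def MemW1Vec {n : ℕ} (Ω : Set (EuclideanSpace ℝ (Fin n))) (p : ℝ≥0∞)
    (f : EuclideanSpace ℝ (Fin n) → EuclideanSpace ℝ (Fin n)) : Prop :=
  ∀ i : Fin n, MemW1 Ω p (fun x => f x i)

open Classical in
/-- A representative of the weak partial derivative of `u` on `Ω` in the `j`-th coordinate
direction (it is unique up to equality almost everywhere on an open `Ω`); by convention `0` if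
there is no weak partial derivative. -/
noncomputable def weakPartial {n : ℕ} (Ω : Set (EuclideanSpace ℝ (Fin n)))
    (u : EuclideanSpace ℝ (Fin n) → ℝ) (j : Fin n) : EuclideanSpace ℝ (Fin n) → ℝ :=
  if h : ∃ g, IsWeakPartial Ω u j g then h.choose else 0

/-- The Jacobian `J_f`: the determinant of the matrix of weak partial derivatives of the
components of `f`. -/
noncomputable def jacobian {n : ℕ} (Ω : Set (EuclideanSpace ℝ (Fin n)))
    (f : EuclideanSpace ℝ (Fin n) → EuclideanSpace ℝ (Fin n))
    (x : EuclideanSpace ℝ (Fin n)) : ℝ :=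
  Matrix.det (Matrix.of fun i j : Fin n => weakPartial Ω (fun z => f z i) j x)

/-- Property (N): the map `f` on `Ω` sends Lebesgue null sets to Lebesgue null sets. -/
def PropertyN {n : ℕ} (Ω : Set (EuclideanSpace ℝ (Fin n)))
    (f : EuclideanSpace ℝ (Fin n) → EuclideanSpace ℝ (Fin n)) : Prop :=
  ∀ E : Set (EuclideanSpace ℝ (Fin n)), E ⊆ Ω → volume E = 0 → volume (f '' E) = 0

/-- The multiplicity function `N(f, E, y)`: the number of points `x ∈ E` with `f x = y`
(`∞` if there are infinitely many). -/
noncomputable def multiplicity {n : ℕ}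
    (f : EuclideanSpace ℝ (Fin n) → EuclideanSpace ℝ (Fin n))
    (E : Set (EuclideanSpace ℝ (Fin n))) (y : EuclideanSpace ℝ (Fin n)) : ℝ≥0∞ :=
  ({x | x ∈ E ∧ f x = y}.encard : ℝ≥0∞)

end SobolevArea

/-!
The area formula with multiplicity for a Sobolev map `f ∈ W^{1,n}(Ω; ℝⁿ)` with property (N) reduces
to the change of variables formula for injective maps that are differentiable relative to a
measurable set. What has to be shown is that `Ω` is, up to a null set, a countable union of
measurable pieces on which `f` itself is differentiable relative to the piece, with the matrix of
weak derivatives `G` as derivative (`HasWeakFDerivOn.exists_seq_hasFDerivWithinAt`). Property (N)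
makes the image of the remaining null set negligible.

The pieces are obtained without Lipschitz truncation or Rademacher's theorem. Let `φ_k` be the
mollification of `f` at scale `2⁻ᵏ` and let `meanOsc G k x` be the mean of `‖G - G x‖` over the ball
of radius `2⁻ᵏ` around `x`. The derivative of `φ_{k+2}` is the mollification of `G`, hence differs
from `G x` by at most a constant times `meanOsc G k x` near `x` (`norm_mollify_sub_le`). Mollifying
`φ_k` once more therefore moves it at `x` by at most a constant times `2⁻ᵏ · meanOsc G k x`. As
mollifications commute, this controls `φ_{k+1} x - φ_k x`, and summing over the scales controls
`f x - φ_k x` (`HasWeakFDerivOn.norm_mollify_sub_self_le`). Comparing `f x`, `φ_k x`, `φ_k y`, `f y`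
at the scale `2⁻ᵏ ∼ ‖x - y‖` bounds `f y - f x - G x (y - x)` by a constant times the mean
oscillations at `x` and `y` times `‖y - x‖`. These tend to zero almost everywhere by Lebesgue's
differentiation theorem, and uniformly on large sets by Egorov's theorem.

On a set where `f` is differentiable relative to the set, the points with singular derivative have a
null image, and the others split into countably many measurable sets on which `f` is injective
(`AreaFormulaOn.of_hasFDerivWithinAt`). Multiplicities and integrals are both countably additive.
-/

namespace SobolevArea

open Filter Metric Set ContinuousLinearMap
open scoped Topology Convolution

/-! ### Mollification of weakly differentiable maps -/

section Mollification

variable {E : Type*} [NormedAddCommGroup E] [NormedSpace ℝ E] [FiniteDimensional ℝ E]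
  [MeasurableSpace E] [BorelSpace E]
  {F : Type*} [NormedAddCommGroup F] [NormedSpace ℝ F]

/-- The smooth bump function at the origin with outer radius `2⁻ᵏ` and inner radius `2⁻ᵏ⁻¹`. -/
noncomputable def dyadicBump (E : Type*) [NormedAddCommGroup E] (k : ℕ) : ContDiffBump (0 : E) where
  rIn := (1 / 2) ^ (k + 1)
  rOut := (1 / 2) ^ k
  rIn_pos := by positivity
  rIn_lt_rOut := pow_lt_pow_right_of_lt_one₀ (by norm_num) (by norm_num) (Nat.lt_succ_self k)

/-- The convolution of `f` with the normalised bump function at scale `2⁻ᵏ`. -/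
noncomputable def mollify (μ : Measure E) (k : ℕ) (f : E → F) : E → F :=
  (dyadicBump E k).normed μ ⋆[lsmul ℝ ℝ, μ] f

/-- The mean oscillation of `g` around its value at `x`, over the ball of radius `2⁻ᵏ`. -/
noncomputable def meanOsc (μ : Measure E) (g : E → F) (k : ℕ) (x : E) : ℝ :=
  ⨍ y in closedBall x ((1 / 2 : ℝ) ^ k), ‖g y - g x‖ ∂μ

/-- `G` is a weak Fréchet derivative of the vector valued map `f` on `Ω`. Integrals are over the
whole space, which is harmless since the test functions are supported in `Ω`. -/
def HasWeakFDerivOn (μ : Measure E) (Ω : Set E) (f : E → F) (G : E → E →L[ℝ] F) : Prop :=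
  ∀ φ : E → ℝ, ContDiff ℝ ∞ φ → HasCompactSupport φ → tsupport φ ⊆ Ω → ∀ v : E,
    ∫ x, φ x • G x v ∂μ = - ∫ x, fderiv ℝ φ x v • f x ∂μ

variable {μ : Measure E} [μ.IsAddHaarMeasure]

omit [NormedSpace ℝ E] [FiniteDimensional ℝ E] [BorelSpace E] [NormedSpace ℝ F]
  [μ.IsAddHaarMeasure] in
lemma meanOsc_nonneg (g : E → F) (k : ℕ) (x : E) : 0 ≤ meanOsc μ g k x := by
  unfold meanOsc
  rw [setAverage_eq]
  exact smul_nonneg (by positivity) (integral_nonneg fun _ => norm_nonneg _)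

lemma integrable_normed_smul_comp_sub (k : ℕ) {g : E → F} (hg : LocallyIntegrable g μ) (x : E) :
    Integrable (fun t => (dyadicBump E k).normed μ (x - t) • g t) μ := by
  have hc : HasCompactSupport ((dyadicBump E k).normed μ) :=
    (dyadicBump E k).hasCompactSupport_normed
  exact (hc.convolutionExists_left (lsmul ℝ ℝ) (dyadicBump E k).continuous_normed hg
    x).integrable_swap

/-- Mollification commutes with weak differentiation at points far enough from the boundary. -/
lemma HasWeakFDerivOn.hasFDerivAt_mollify [CompleteSpace F] {Ω : Set E} {f : E → F}
    {G : E → E →L[ℝ] F} (h : HasWeakFDerivOn μ Ω f G) (hf : LocallyIntegrable f μ)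
    (hG : LocallyIntegrable G μ) {k : ℕ} {x : E} (hx : closedBall x ((1 / 2 : ℝ) ^ k) ⊆ Ω) :
    HasFDerivAt (mollify μ k f) (mollify μ k G x) x := by
  set ρ := (dyadicBump E k).normed μ with hρ
  have hc : HasCompactSupport ρ := (dyadicBump E k).hasCompactSupport_normed
  have hs : ContDiff ℝ ∞ ρ := (dyadicBump E k).contDiff_normed
  have hs1 : ContDiff ℝ 1 ρ := hs.of_le (by norm_cast)
  have key := hc.hasFDerivAt_convolution_left (lsmul ℝ ℝ : ℝ →L[ℝ] F →L[ℝ] F) hs1 hf x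
  have : mollify μ k G x = (fderiv ℝ ρ ⋆[(lsmul ℝ ℝ : ℝ →L[ℝ] F →L[ℝ] F).precompL E, μ] f) x := by
    ext v
    have e1 : mollify μ k G x v = ∫ t, ρ (x - t) • G t v ∂μ := by
      rw [mollify, convolution_lsmul_swap, ContinuousLinearMap.integral_apply]
      · rfl
      · exact integrable_normed_smul_comp_sub k hG x
    have e2 : (fderiv ℝ ρ ⋆[(lsmul ℝ ℝ : ℝ →L[ℝ] F →L[ℝ] F).precompL E, μ] f) x v =
        ∫ t, fderiv ℝ ρ (x - t) v • f t ∂μ := by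
      rw [convolution_eq_swap, ContinuousLinearMap.integral_apply]
      · rfl
      · exact ((hc.fderiv ℝ).convolutionExists_left _ (hs1.continuous_fderiv one_ne_zero) hf
          x).integrable_swap
    have hts : tsupport (fun t => ρ (x - t)) ⊆ closedBall x ((1 / 2 : ℝ) ^ k) := by
      refine closure_minimal (fun t ht => ?_) isClosed_closedBall
      have : x - t ∈ Function.support ρ := ht
      rw [hρ, ContDiffBump.support_normed_eq, mem_ball_zero_iff] at this
      rw [mem_closedBall, dist_eq_norm, norm_sub_rev]
      exact this.le
    have hcs : HasCompactSupport (fun t => ρ (x - t)) :=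
      (isCompact_closedBall x _).of_isClosed_subset (isClosed_tsupport _) hts
    have := h (fun t => ρ (x - t)) (hs.comp (contDiff_const.sub contDiff_id)) hcs
      (hts.trans hx) v
    rw [e1, e2, this, ← integral_neg]
    refine integral_congr_ae (Eventually.of_forall fun t => ?_)
    have hd : HasFDerivAt (fun t => ρ (x - t)) (-(fderiv ℝ ρ (x - t))) t := by
      have h1 : HasFDerivAt ρ (fderiv ℝ ρ (x - t)) (x - t) :=
        (hs1.differentiable one_ne_zero _).hasFDerivAt
      have h2 : HasFDerivAt (fun t : E => x - t) (-(ContinuousLinearMap.id ℝ E)) t :=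
        (hasFDerivAt_id t).const_sub x
      have h3 := h1.comp t h2
      rw [comp_neg, comp_id] at h3
      exact h3
    simp [hd.fderiv]
  rw [this]
  exact key

/-- The mollification of `g` near `x` is controlled by the mean oscillation of `g` around `g x`. -/
lemma norm_mollify_sub_le [CompleteSpace F] {g : E → F} (hg : LocallyIntegrable g μ) {k : ℕ}
    {x z : E} (hz : z ∈ closedBall x ((1 / 2 : ℝ) ^ (k + 1))) :
    ‖mollify μ (k + 2) g z - g x‖ ≤ 8 ^ Module.finrank ℝ E * meanOsc μ g k x := by
  set ρ := (dyadicBump E (k + 2)).normed μ with hρ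
  set d := Module.finrank ℝ E
  have hr : (0 : ℝ) < (1 / 2) ^ k := by positivity
  have hint := integrable_normed_smul_comp_sub (k + 2) hg z
  have hint' : Integrable (fun t => ρ (z - t)) μ :=
    (dyadicBump E (k + 2)).integrable_normed.comp_sub_left z
  have e1 : mollify μ (k + 2) g z - g x = ∫ t, ρ (z - t) • (g t - g x) ∂μ := by
    have : ∫ t, ρ (z - t) • g x ∂μ = g x := by
      rw [integral_smul_const, integral_sub_left_eq_self ρ μ z,
        (dyadicBump E (k + 2)).integral_normed, one_smul]
    simp_rw [smul_sub]
    rw [integral_sub hint (hint'.smul_const _), this, mollify, convolution_lsmul_swap]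
  set B := closedBall x ((1 / 2 : ℝ) ^ k)
  -- `ρ` is at most `2 ^ d` over the volume of a ball of radius `2⁻ᵏ⁻²`, which is `4⁻ᵈ μ B`.
  have hbound : ∀ t, ‖ρ (z - t) • (g t - g x)‖ ≤
      B.indicator (fun t => (8 ^ d / μ.real B) * ‖g t - g x‖) t := by
    intro t
    by_cases ht : t ∈ B
    · rw [indicator_of_mem ht, norm_smul,
        Real.norm_of_nonneg ((dyadicBump E (k + 2)).nonneg_normed _)]
      gcongr
      refine ((dyadicBump E (k + 2)).normed_le_div_measure_closedBall_rOut μ 2 ?_ (z - t)).trans ?_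
      · simp only [dyadicBump]; rw [pow_succ _ (k + 2)]; linarith
      · have : μ.real B = 4 ^ d * μ.real (closedBall (0 : E) (dyadicBump E (k + 2)).rOut) := by
          have h4 : ((1 : ℝ) / 2) ^ k = 4 * (1 / 2) ^ (k + 2) := by ring
          rw [show (dyadicBump E (k + 2)).rOut = (1 / 2) ^ (k + 2) from rfl]
          rw [show B = closedBall x (4 * (1 / 2 : ℝ) ^ (k + 2)) by rw [← h4]]
          rw [Measure.addHaar_real_closedBall μ x (by positivity),
            Measure.addHaar_real_closedBall μ 0 (by positivity), mul_pow, mul_assoc]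
        rw [this, show (8 : ℝ) ^ d = 4 ^ d * 2 ^ d by rw [← mul_pow]; norm_num,
          mul_div_mul_left _ _ (by positivity)]
    · have : ρ (z - t) = 0 := by
        by_contra h0
        have : z - t ∈ Function.support ρ := h0
        rw [hρ, ContDiffBump.support_normed_eq, mem_ball_zero_iff] at this
        refine ht ?_
        rw [mem_closedBall] at hz ⊢
        have h1 : dist t z < (1 / 2 : ℝ) ^ (k + 2) := by rw [dist_comm, dist_eq_norm]; exact this
        have h2 := dist_triangle t z x
        have h3 : ((1 : ℝ) / 2) ^ (k + 2) = (1 / 4) * (1 / 2) ^ k := by ring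
        have h4 : ((1 : ℝ) / 2) ^ (k + 1) = (1 / 2) * (1 / 2) ^ k := by ring
        linarith
      rw [this, zero_smul, norm_zero, indicator_of_notMem ht]
  have hBint : IntegrableOn (fun t => ‖g t - g x‖) B μ :=
    ((hg.integrableOn_isCompact (isCompact_closedBall _ _)).sub
      (integrableOn_const (measure_closedBall_lt_top).ne)).norm
  rw [e1]
  calc ‖∫ t, ρ (z - t) • (g t - g x) ∂μ‖
      ≤ ∫ t, B.indicator (fun t => (8 ^ d / μ.real B) * ‖g t - g x‖) t ∂μ :=
        norm_integral_le_of_norm_le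
          (IntegrableOn.integrable_indicator (hBint.const_mul _) measurableSet_closedBall)
          (Eventually.of_forall hbound)
    _ = 8 ^ d * meanOsc μ g k x := by
        rw [integral_indicator measurableSet_closedBall, integral_const_mul, meanOsc,
          setAverage_eq, smul_eq_mul, div_eq_mul_inv, mul_assoc]

/-- Near `x` the mollified map minus its candidate linear part `G x` is Lipschitz, with a constant
given by the mean oscillation of `G`. -/
lemma HasWeakFDerivOn.norm_mollify_sub_sub_le [CompleteSpace F] {Ω : Set E} {f : E → F}
    {G : E → E →L[ℝ] F} (h : HasWeakFDerivOn μ Ω f G) (hf : LocallyIntegrable f μ)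
    (hG : LocallyIntegrable G μ) {k : ℕ} {x : E} (hx : closedBall x ((1 / 2 : ℝ) ^ k) ⊆ Ω)
    {z w : E} (hz : z ∈ closedBall x ((1 / 2 : ℝ) ^ (k + 1)))
    (hw : w ∈ closedBall x ((1 / 2 : ℝ) ^ (k + 1))) :
    ‖mollify μ (k + 2) f z - mollify μ (k + 2) f w - G x (z - w)‖ ≤
      8 ^ Module.finrank ℝ E * meanOsc μ G k x * ‖z - w‖ := by
  refine (convex_closedBall x ((1 / 2 : ℝ) ^ (k + 1))).norm_image_sub_le_of_norm_hasFDerivWithin_le'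
    (f' := mollify μ (k + 2) G) (fun y hy => ?_) (fun y hy => norm_mollify_sub_le hG hy) hw hz
  refine (h.hasFDerivAt_mollify hf hG (Subset.trans (closedBall_subset_closedBall' ?_)
    hx)).hasFDerivWithinAt
  rw [mem_closedBall] at hy
  have h3 : ((1 : ℝ) / 2) ^ (k + 2) = (1 / 4) * (1 / 2) ^ k := by ring
  have h4 : ((1 : ℝ) / 2) ^ (k + 1) = (1 / 2) * (1 / 2) ^ k := by ring
  have hr : (0 : ℝ) < (1 / 2) ^ k := by positivity
  linarith

lemma continuous_mollify [CompleteSpace F] (k : ℕ) {f : E → F} (hf : LocallyIntegrable f μ) :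
    Continuous (mollify μ k f) :=
  (dyadicBump E k).hasCompactSupport_normed.continuous_convolution_left _
    (dyadicBump E k).continuous_normed hf

/-- Mollifying a second time moves the mollified map only little: the first-order term integrates
to zero because the bump function is even. -/
lemma HasWeakFDerivOn.norm_mollify_sub_mollify_mollify_le [CompleteSpace F] {Ω : Set E} {f : E → F}
    {G : E → E →L[ℝ] F} (h : HasWeakFDerivOn μ Ω f G) (hf : LocallyIntegrable f μ)
    (hG : LocallyIntegrable G μ) {k j : ℕ} (hkj : k + 1 ≤ j) {x : E}
    (hx : closedBall x ((1 / 2 : ℝ) ^ k) ⊆ Ω) :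
    ‖mollify μ (k + 2) f x - mollify μ j (mollify μ (k + 2) f) x‖ ≤
      8 ^ Module.finrank ℝ E * meanOsc μ G k x * (1 / 2) ^ (k + 1) := by
  set ρ := (dyadicBump E j).normed μ with hρ
  set φ := mollify μ (k + 2) f
  have hφ : Continuous φ := continuous_mollify _ hf
  have hcρ : HasCompactSupport ρ := (dyadicBump E j).hasCompactSupport_normed
  have hρc : Continuous ρ := (dyadicBump E j).continuous_normed
  have i1 : Integrable (fun t => ρ t • φ x) μ :=
    (dyadicBump E j).integrable_normed.smul_const _
  have i2 : Integrable (fun t => ρ t • φ (x - t)) μ :=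
    (hρc.smul (hφ.comp (continuous_const.sub continuous_id))).integrable_of_hasCompactSupport
      hcρ.smul_right
  have i3 : Integrable (fun t => ρ t • G x t) μ :=
    (hρc.smul (G x).continuous).integrable_of_hasCompactSupport hcρ.smul_right
  have z3 : ∫ t, ρ t • G x t ∂μ = 0 := by
    have e : ∫ t, ρ t • G x t ∂μ = - ∫ t, ρ t • G x t ∂μ := by
      conv_lhs => rw [← integral_neg_eq_self]
      rw [← integral_neg]
      refine integral_congr_ae (Eventually.of_forall fun t => ?_)
      simp [hρ, ContDiffBump.normed_neg]
    have h2 : (2 : ℝ) • ∫ t, ρ t • G x t ∂μ = 0 := by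
      rw [two_smul]; nth_rewrite 1 [e]; exact neg_add_cancel _
    exact (smul_eq_zero.1 h2).resolve_left two_ne_zero
  have e : φ x - mollify μ j φ x = ∫ t, ρ t • (φ x - φ (x - t) - G x (x - (x - t))) ∂μ := by
    have : ∀ t, ρ t • (φ x - φ (x - t) - G x (x - (x - t))) =
        ρ t • φ x - ρ t • φ (x - t) - ρ t • G x t := fun t => by
      rw [sub_sub_cancel, smul_sub, smul_sub]
    simp_rw [this]
    rw [integral_sub (by exact i1.sub i2) i3, integral_sub i1 i2, z3, sub_zero,
      ContDiffBump.integral_normed_smul]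
    rfl
  rw [e]
  have hM : 0 ≤ 8 ^ Module.finrank ℝ E * meanOsc μ G k x :=
    mul_nonneg (by positivity) (meanOsc_nonneg _ _ _)
  set M := 8 ^ Module.finrank ℝ E * meanOsc μ G k x
  refine (norm_integral_le_of_norm_le (g := fun t => ρ t * (M * (1 / 2) ^ (k + 1)))
    ((dyadicBump E j).integrable_normed.mul_const _) (Eventually.of_forall fun t => ?_)).trans ?_
  · rw [norm_smul, Real.norm_of_nonneg ((dyadicBump E j).nonneg_normed _)]
    by_cases ht : ρ t = 0
    · simp [← hρ, ht]
    have ht' : ‖t‖ ≤ (1 / 2) ^ (k + 1) := by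
      have : t ∈ Function.support ρ := ht
      rw [hρ, ContDiffBump.support_normed_eq, mem_ball_zero_iff] at this
      refine this.le.trans ?_
      exact pow_le_pow_of_le_one (by norm_num) (by norm_num) hkj
    refine mul_le_mul_of_nonneg_left ?_ ((dyadicBump E j).nonneg_normed _)
    refine (h.norm_mollify_sub_sub_le hf hG hx (mem_closedBall_self (by positivity)) ?_).trans ?_
    · rw [mem_closedBall, dist_eq_norm]; simpa using ht'
    · rw [sub_sub_cancel]
      exact mul_le_mul_of_nonneg_left ht' hM
  · rw [integral_mul_const, (dyadicBump E j).integral_normed, one_mul]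

/-- Associativity and commutativity of convolution. -/
lemma mollify_comm [CompleteSpace F] (j k : ℕ) {f : E → F} (hf : LocallyIntegrable f μ) (x : E) :
    mollify μ j (mollify μ k f) x = mollify μ k (mollify μ j f) x := by
  have key : ∀ j k : ℕ, (((dyadicBump E j).normed μ ⋆[mul ℝ ℝ, μ] (dyadicBump E k).normed μ)
      ⋆[lsmul ℝ ℝ, μ] f) x = mollify μ j (mollify μ k f) x := by
    intro j k
    have hj : HasCompactSupport ((dyadicBump E j).normed μ) :=
      (dyadicBump E j).hasCompactSupport_normed
    have hk : HasCompactSupport ((dyadicBump E k).normed μ) :=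
      (dyadicBump E k).hasCompactSupport_normed
    have cj : Continuous ((dyadicBump E j).normed μ) := (dyadicBump E j).continuous_normed
    have ck : Continuous ((dyadicBump E k).normed μ) := (dyadicBump E k).continuous_normed
    have hfn : LocallyIntegrable (fun x => ‖f x‖) μ := fun y => (hf y).norm
    refine convolution_assoc (mul ℝ ℝ) (lsmul ℝ ℝ) (lsmul ℝ ℝ) (lsmul ℝ ℝ)
      (fun a b c => mul_smul a b c) cj.aestronglyMeasurable ck.aestronglyMeasurable
      hf.aestronglyMeasurable
      (Eventually.of_forall (hj.convolutionExists_left _ cj ck.locallyIntegrable))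
      (Eventually.of_forall (hk.norm.convolutionExists_left _ ck.norm hfn)) ?_
    exact hj.norm.convolutionExists_left _ cj.norm
      (hk.norm.continuous_convolution_left _ ck.norm hfn).locallyIntegrable x
  rw [← key, ← key]
  congr 1
  ext y
  rw [convolution_mul_swap]
  simp_rw [convolution_def, mul_apply', mul_comm]

/-- The distance from the mollified map to the map is controlled by the mean oscillations at all
smaller scales: since mollifications commute, two consecutive scales are compared through their
common second mollification, and the resulting geometric series is summed. -/
lemma HasWeakFDerivOn.norm_mollify_sub_self_le [CompleteSpace F] {Ω : Set E} {f : E → F}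
    {G : E → E →L[ℝ] F} (h : HasWeakFDerivOn μ Ω f G) (hf : LocallyIntegrable f μ)
    (hG : LocallyIntegrable G μ) {k : ℕ} {x : E} (hx : closedBall x ((1 / 2 : ℝ) ^ k) ⊆ Ω)
    (hlim : Tendsto (fun k => mollify μ k f x) atTop (𝓝 (f x))) {η : ℝ}
    (hη : ∀ j ≥ k, meanOsc μ G j x ≤ η) :
    ‖mollify μ (k + 2) f x - f x‖ ≤ 2 * (8 ^ Module.finrank ℝ E * η * (1 / 2) ^ k) := by
  set D : ℝ := 8 ^ Module.finrank ℝ E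
  have hD : 0 < D := by positivity
  have hη0 : 0 ≤ η := (meanOsc_nonneg G k x).trans (hη k le_rfl)
  rw [← dist_eq_norm]
  have hl : Tendsto (fun m => mollify μ (k + m + 2) f x) atTop (𝓝 (f x)) :=
    hlim.comp (tendsto_atTop_mono (fun m => by simp only [id]; omega) tendsto_id)
  suffices H : ∀ m, dist (mollify μ (k + m + 2) f x) (mollify μ (k + (m + 1) + 2) f x) ≤
      2 * (D * η * (1 / 2) ^ k) / 2 / 2 ^ m from
    dist_le_of_le_geometric_two_of_tendsto₀ H hl
  intro m
  have hsub : ∀ i ≥ k, closedBall x ((1 / 2 : ℝ) ^ i) ⊆ Ω := fun i hi =>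
    (closedBall_subset_closedBall
      (pow_le_pow_of_le_one (by norm_num) (by norm_num) hi)).trans hx
  have h1 := h.norm_mollify_sub_mollify_mollify_le hf hG (k := k + m) (j := k + m + 3) (by omega)
    (hsub _ (by omega))
  have h2 := h.norm_mollify_sub_mollify_mollify_le hf hG (k := k + m + 1) (j := k + m + 2)
    (by omega) (hsub _ (by omega))
  rw [show k + m + 1 + 2 = k + m + 3 by omega, mollify_comm _ _ hf, ← dist_eq_norm] at h2
  rw [← dist_eq_norm] at h1
  rw [show k + (m + 1) + 2 = k + m + 3 by omega]
  have hp : (0 : ℝ) < (1 / 2) ^ (k + m) := by positivity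
  have b1 : D * meanOsc μ G (k + m) x * (1 / 2) ^ (k + m + 1) ≤ D * η * (1 / 2) ^ (k + m + 1) := by
    gcongr; exact hη _ (by omega)
  have b2 : D * meanOsc μ G (k + m + 1) x * (1 / 2) ^ (k + m + 1 + 1) ≤
      D * η * (1 / 2) ^ (k + m + 1 + 1) := by
    gcongr; exact hη _ (by omega)
  have h3 := dist_triangle_right (mollify μ (k + m + 2) f x) (mollify μ (k + m + 3) f x)
    (mollify μ (k + m + 3) (mollify μ (k + m + 2) f) x)
  have e3 : D * η * (1 / 2) ^ (k + m + 1) = (1 / 2) * (D * η * (1 / 2) ^ (k + m)) := by ring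
  have e4 : D * η * (1 / 2) ^ (k + m + 1 + 1) = (1 / 4) * (D * η * (1 / 2) ^ (k + m)) := by ring
  have e5 : 2 * (D * η * (1 / 2) ^ k) / 2 / 2 ^ m = D * η * (1 / 2) ^ (k + m) := by
    rw [pow_add, one_div_pow, one_div_pow]; field_simp
  have hpos : 0 ≤ D * η * (1 / 2) ^ (k + m) := by positivity
  rw [e5]
  linarith

/-- On a set where the mean oscillations of the weak derivative tend to zero uniformly, the map is
differentiable relative to this set, with the weak derivative as derivative. -/
lemma HasWeakFDerivOn.hasFDerivWithinAt [CompleteSpace F] {Ω : Set E} (hΩ : IsOpen Ω) {f : E → F}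
    {G : E → E →L[ℝ] F} (h : HasWeakFDerivOn μ Ω f G) (hf : LocallyIntegrable f μ)
    (hG : LocallyIntegrable G μ) {A : Set E} (hA : A ⊆ Ω)
    (hlim : ∀ x ∈ A, Tendsto (fun k => mollify μ k f x) atTop (𝓝 (f x)))
    (hunif : TendstoUniformlyOn (meanOsc μ G) 0 atTop A) {x : E} (hx : x ∈ A) :
    HasFDerivWithinAt f (G x) A x := by
  set D : ℝ := 8 ^ Module.finrank ℝ E with hDdef
  have hD : 0 < D := by positivity
  rw [hasFDerivWithinAt_iff_isLittleO, Asymptotics.isLittleO_iff]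
  intro c hc
  -- The total error below is at most `(8 + 1 + 8) * D * η * ‖y - x‖`.
  set η := c / (17 * D) with hηdef
  have hη : 0 < η := by positivity
  obtain ⟨k₀, hk₀⟩ := eventually_atTop.1 (Metric.tendstoUniformlyOn_iff.1 hunif η hη)
  have hk₀' : ∀ k ≥ k₀, ∀ y ∈ A, meanOsc μ G k y ≤ η := fun k hk y hy => by
    have := hk₀ k hk y hy
    rw [dist_comm, Real.dist_eq, Pi.zero_apply, sub_zero] at this
    exact (le_abs_self _).trans this.le
  obtain ⟨ε, hε, hεΩ⟩ := Metric.isOpen_iff.1 hΩ x (hA hx)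
  have hev : ∀ᶠ y in 𝓝[A] x, dist y x < min (ε / 8) ((1 / 2) ^ (k₀ + 2)) :=
    nhdsWithin_le_nhds (Metric.ball_mem_nhds x (by positivity))
  filter_upwards [hev, self_mem_nhdsWithin] with y hy hyA
  rcases eq_or_ne y x with rfl | hne
  · simp
  have hd : 0 < dist y x := dist_pos.2 hne
  obtain ⟨hy1, hy2⟩ := lt_min_iff.1 hy
  -- The dyadic scale is chosen comparable to the distance of `x` and `y`.
  obtain ⟨m, hm1, hm2⟩ := exists_nat_pow_near_of_lt_one hd
    (hy2.le.trans (pow_le_one₀ (by norm_num) (by norm_num))) (by norm_num : (0 : ℝ) < 1 / 2)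
    (by norm_num)
  have hm : k₀ + 1 < m := by
    have := hm1.trans hy2
    have := (pow_lt_pow_iff_right_of_lt_one₀ (by norm_num : (0 : ℝ) < 1 / 2) (by norm_num)).1 this
    omega
  obtain ⟨k, rfl⟩ : ∃ k, m = k + 1 := ⟨m - 1, by omega⟩
  have hr4 : ((1 : ℝ) / 2) ^ k < 4 * dist y x := by
    have : ((1 : ℝ) / 2) ^ (k + 1 + 1) = (1 / 4) * (1 / 2) ^ k := by ring
    linarith
  have hbx : closedBall x ((1 / 2 : ℝ) ^ k) ⊆ Ω :=
    (closedBall_subset_ball (by linarith)).trans hεΩ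
  have hby : closedBall y ((1 / 2 : ℝ) ^ k) ⊆ Ω := by
    refine Subset.trans (fun w hw => ?_) hεΩ
    rw [mem_closedBall] at hw
    rw [mem_ball]
    linarith [dist_triangle w y x]
  have h1 := h.norm_mollify_sub_self_le hf hG hbx (hlim x hx) (η := η)
    (fun j hj => hk₀' j (by omega) x hx)
  have h2 := h.norm_mollify_sub_self_le hf hG hby (hlim y hyA) (η := η)
    (fun j hj => hk₀' j (by omega) y hyA)
  have h3 := h.norm_mollify_sub_sub_le hf hG hbx (z := y) (w := x) hm2
    (mem_closedBall_self (by positivity))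
  have h4 := hk₀' k (by omega) x hx
  rw [← hDdef] at h1 h2 h3
  have h3' : D * meanOsc μ G k x * ‖y - x‖ ≤ D * η * ‖y - x‖ := by gcongr
  have h5 : D * η * (1 / 2) ^ k ≤ D * η * (4 * ‖y - x‖) := by
    rw [← dist_eq_norm]; gcongr
  have e : f y - f x - G x (y - x) =
      (mollify μ (k + 2) f y - mollify μ (k + 2) f x - G x (y - x))
      - (mollify μ (k + 2) f y - f y) + (mollify μ (k + 2) f x - f x) := by abel
  have e6 : D * η * 17 = c := by rw [hηdef]; field_simp
  rw [e]
  calc _ ≤ _ := (norm_add_le _ _).trans (add_le_add (norm_sub_le _ _) le_rfl)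
    _ ≤ (D * η * 17) * ‖y - x‖ := by linarith
    _ = c * ‖y - x‖ := by rw [e6]

end Mollification
/-! ### Decomposition into pieces of relative differentiability -/

section Decomposition

variable {E : Type*} [NormedAddCommGroup E] [NormedSpace ℝ E] [FiniteDimensional ℝ E]
  [MeasurableSpace E] [BorelSpace E]
  {F : Type*} [NormedAddCommGroup F] [NormedSpace ℝ F] {μ : Measure E} [μ.IsAddHaarMeasure]

omit [NormedSpace ℝ F] in
lemma stronglyMeasurable_meanOsc {g : E → F} (hg : StronglyMeasurable g) (k : ℕ) :
    StronglyMeasurable (meanOsc μ g k) := by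
  set S : Set (E × E) := {p | dist p.2 p.1 ≤ (1 / 2 : ℝ) ^ k}
  have hS : MeasurableSet S := (isClosed_le (by fun_prop) continuous_const).measurableSet
  have h1 : StronglyMeasurable (S.indicator fun p : E × E => ‖g p.2 - g p.1‖) :=
    ((hg.comp_measurable measurable_snd).sub (hg.comp_measurable measurable_fst)).norm.indicator hS
  have h2 : meanOsc μ g k = fun x => (μ.real (closedBall (0 : E) ((1 / 2) ^ k)))⁻¹ *
      ∫ y, S.indicator (fun p : E × E => ‖g p.2 - g p.1‖) (x, y) ∂μ := by
    ext x
    rw [meanOsc, setAverage_eq, Measure.addHaar_real_closedBall_center, smul_eq_mul,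
      ← integral_indicator measurableSet_closedBall]
    rfl
  rw [h2]
  exact (StronglyMeasurable.integral_prod_right (ν := μ) (f := fun x y =>
    S.indicator (fun p : E × E => ‖g p.2 - g p.1‖) (x, y)) h1).const_mul _

omit [NormedSpace ℝ F] in
lemma ae_tendsto_meanOsc {g : E → F} (hg : LocallyIntegrable g μ) :
    ∀ᵐ x ∂μ, Tendsto (fun k => meanOsc μ g k x) atTop (𝓝 0) := by
  filter_upwards [(Besicovitch.vitaliFamily μ).ae_tendsto_average_norm_sub hg] with x hx
  refine (hx.comp (Besicovitch.tendsto_filterAt μ x)).comp (tendsto_nhdsWithin_iff.2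
    ⟨tendsto_pow_atTop_nhds_zero_of_lt_one (by norm_num) (by norm_num),
      Eventually.of_forall fun k => ?_⟩)
  exact mem_Ioi.2 (by positivity)

lemma ae_tendsto_mollify [CompleteSpace F] {f : E → F} (hf : LocallyIntegrable f μ) :
    ∀ᵐ x ∂μ, Tendsto (fun k => mollify μ k f x) atTop (𝓝 (f x)) := by
  refine ContDiffBump.ae_convolution_tendsto_right_of_locallyIntegrable (K := 2) ?_
    (Eventually.of_forall fun k => ?_) hf
  · exact tendsto_pow_atTop_nhds_zero_of_lt_one (by norm_num) (by norm_num)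
  · simp only [dyadicBump]
    exact le_of_eq (by ring)

/-- A weakly differentiable map is, off a null set, a countable union of pieces on which it is
differentiable relative to the piece, with the weak derivative as derivative. The pieces come from
Egorov's theorem applied to the mean oscillations of the weak derivative. -/
theorem HasWeakFDerivOn.exists_seq_hasFDerivWithinAt [CompleteSpace F] {Ω : Set E} (hΩ : IsOpen Ω)
    {f : E → F} {G : E → E →L[ℝ] F} (h : HasWeakFDerivOn μ Ω f G) (hf : LocallyIntegrable f μ)
    (hG : LocallyIntegrable G μ) (hGm : StronglyMeasurable G) :
    ∃ A : ℕ × ℕ → Set E, (∀ i, MeasurableSet (A i)) ∧ (∀ i, A i ⊆ Ω) ∧ μ (Ω \ ⋃ i, A i) = 0 ∧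
      ∀ i, ∀ x ∈ A i, HasFDerivWithinAt f (G x) (A i) x := by
  set N := toMeasurable μ {x | ¬ Tendsto (fun k => mollify μ k f x) atTop (𝓝 (f x))} with hNdef
  have hN : μ N = 0 := by rw [hNdef, measure_toMeasurable]; exact ae_tendsto_mollify hf
  have hegorov : ∀ i : ℕ × ℕ, ∃ t ⊆ Ω ∩ closedBall 0 i.1, MeasurableSet t ∧
      μ t ≤ ENNReal.ofReal (1 / ((i.2 : ℝ) + 1)) ∧
      TendstoUniformlyOn (meanOsc μ G) 0 atTop ((Ω ∩ closedBall 0 i.1) \ t) := fun i =>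
    tendstoUniformlyOn_of_ae_tendsto (stronglyMeasurable_meanOsc hGm) stronglyMeasurable_zero
      (hΩ.measurableSet.inter measurableSet_closedBall)
      ((measure_mono inter_subset_right).trans_lt measure_closedBall_lt_top).ne
      ((ae_tendsto_meanOsc hG).mono fun x hx _ => hx) (by positivity)
  choose t hts htm htμ htu using hegorov
  refine ⟨fun i => ((Ω ∩ closedBall 0 i.1) \ t i) \ N, fun i =>
    ((hΩ.measurableSet.inter measurableSet_closedBall).diff (htm i)).diff
      (measurableSet_toMeasurable _ _), fun i x hx => hx.1.1.1, ?_, fun i x hx => ?_⟩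
  · have hz : ∀ m : ℕ, μ (⋂ l, t (m, l)) = 0 := fun m => by
      refine le_antisymm (ge_of_tendsto' (f := fun l : ℕ => ENNReal.ofReal (1 / ((l : ℝ) + 1)))
        (x := atTop) ?_ fun l => (measure_mono (iInter_subset _ l)).trans (htμ (m, l))) zero_le
      rw [← ENNReal.ofReal_zero]
      exact ENNReal.tendsto_ofReal tendsto_one_div_add_atTop_nhds_zero_nat
    refine measure_mono_null (t := N ∪ ⋃ m : ℕ, ⋂ l, t (m, l)) (fun x hx => ?_)
      (measure_union_null hN (measure_iUnion_null hz))
    by_contra hc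
    simp only [mem_union, mem_iUnion, mem_iInter, not_or, not_exists, not_forall] at hc
    obtain ⟨m, hm⟩ := exists_nat_ge (dist x 0)
    obtain ⟨l, hl⟩ := hc.2 m
    exact hx.2 (mem_iUnion.2 ⟨(m, l), ⟨⟨hx.1, mem_closedBall.2 hm⟩, hl⟩, hc.1⟩)
  · refine h.hasFDerivWithinAt hΩ hf hG (fun x hx => hx.1.1.1) (fun x hx => ?_)
      ((htu i).mono sdiff_subset) hx
    by_contra hc
    exact hx.2 (subset_toMeasurable _ _ hc)

omit [MeasurableSpace E] [BorelSpace E] in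
/-- A map sufficiently well approximated by an invertible linear map is injective. -/
lemma exists_injOn_of_approximatesLinearOn (A : E →L[ℝ] E) :
    ∃ c : NNReal, c ≠ 0 ∧ (A.det ≠ 0 → ∀ (f : E → E) (s : Set E),
      ApproximatesLinearOn f A s c → InjOn f s) := by
  by_cases hA : A.det = 0
  · exact ⟨1, one_ne_zero, fun h => absurd hA h⟩
  set B := A.toContinuousLinearEquivOfDetNeZero hA
  have hB : (B : E →L[ℝ] E) = A := A.coe_toContinuousLinearEquivOfDetNeZero hA
  rcases subsingleton_or_nontrivial E with hE | hE
  · exact ⟨1, one_ne_zero, fun _ f s _ => Function.injective_of_subsingleton f |>.injOn⟩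
  have hpos : 0 < ‖(B.symm : E →L[ℝ] E)‖₊⁻¹ := inv_pos.2 B.nnnorm_symm_pos
  refine ⟨‖(B.symm : E →L[ℝ] E)‖₊⁻¹ / 2, (half_pos hpos).ne', fun _ f s hf => ?_⟩
  rw [← hB] at hf
  exact hf.injOn (Or.inr (NNReal.half_lt_self hpos.ne'))

end Decomposition

/-! ### The area formula for relatively differentiable maps -/

section Area

variable {n : ℕ}

/-- The area formula for `f` on the set `S`, with `J` in the place of the Jacobian. -/
def AreaFormulaOn (f : EuclideanSpace ℝ (Fin n) → EuclideanSpace ℝ (Fin n))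
    (J : EuclideanSpace ℝ (Fin n) → ℝ) (S : Set (EuclideanSpace ℝ (Fin n))) : Prop :=
  AEMeasurable (multiplicity f S) volume ∧
    ∫⁻ x in S, ENNReal.ofReal |J x| = ∫⁻ y, multiplicity f S y

variable {f : EuclideanSpace ℝ (Fin n) → EuclideanSpace ℝ (Fin n)}
  {J : EuclideanSpace ℝ (Fin n) → ℝ} {S : Set (EuclideanSpace ℝ (Fin n))}

lemma multiplicity_eq_tsum (f : EuclideanSpace ℝ (Fin n) → EuclideanSpace ℝ (Fin n))
    (S : Set (EuclideanSpace ℝ (Fin n))) (y : EuclideanSpace ℝ (Fin n)) :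
    multiplicity f S y =
      ∑' x, S.indicator (fun x => ({y} : Set (EuclideanSpace ℝ (Fin n))).indicator 1 (f x)) x := by
  classical
  rw [multiplicity, ← ENNReal.tsum_set_one,
    tsum_subtype {x | x ∈ S ∧ f x = y} (fun _ => (1 : ℝ≥0∞))]
  refine tsum_congr fun x => ?_
  by_cases hx : x ∈ S <;> by_cases hy : f x = y <;> simp [hx, hy]

lemma multiplicity_iUnion {ι : Type*} {s : ι → Set (EuclideanSpace ℝ (Fin n))}
    (hs : Pairwise (Function.onFun Disjoint s)) (y : EuclideanSpace ℝ (Fin n)) :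
    multiplicity f (⋃ i, s i) y = ∑' i, multiplicity f (s i) y := by
  simp_rw [multiplicity_eq_tsum]
  rw [ENNReal.tsum_comm]
  refine tsum_congr fun x => ?_
  by_cases hx : x ∈ ⋃ i, s i
  · obtain ⟨i, hi⟩ := mem_iUnion.1 hx
    rw [indicator_of_mem hx, tsum_eq_single i, indicator_of_mem hi]
    intro j hj
    exact indicator_of_notMem (fun h => disjoint_left.1 (hs hj) h hi) _
  · rw [indicator_of_notMem hx]
    symm
    rw [ENNReal.tsum_eq_zero]
    exact fun i => indicator_of_notMem (fun h => hx (mem_iUnion.2 ⟨i, h⟩)) _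

lemma AreaFormulaOn.iUnion {ι : Type*} [Countable ι] {s : ι → Set (EuclideanSpace ℝ (Fin n))}
    (hd : Pairwise (Function.onFun Disjoint s)) (hm : ∀ i, MeasurableSet (s i))
    (h : ∀ i, AreaFormulaOn f J (s i)) : AreaFormulaOn f J (⋃ i, s i) := by
  have e : multiplicity f (⋃ i, s i) = fun y => ∑' i, multiplicity f (s i) y :=
    funext (multiplicity_iUnion hd)
  constructor
  · rw [e]
    exact AEMeasurable.tsum fun i => (h i).1
  · rw [e, lintegral_iUnion hm hd, lintegral_tsum fun i => (h i).1]
    exact tsum_congr fun i => (h i).2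

lemma AreaFormulaOn.union {T : Set (EuclideanSpace ℝ (Fin n))} (hd : Disjoint S T)
    (hS : MeasurableSet S) (hT : MeasurableSet T) (h : AreaFormulaOn f J S)
    (h' : AreaFormulaOn f J T) :
    AreaFormulaOn f J (S ∪ T) := by
  rw [union_eq_iUnion]
  refine AreaFormulaOn.iUnion ?_ ?_ ?_
  · rintro (_ | _) (_ | _) hne <;> simp_all [Function.onFun, disjoint_comm]
  · rintro (_ | _) <;> assumption
  · rintro (_ | _) <;> assumption

lemma AreaFormulaOn.of_image_null (hS : volume (f '' S) = 0)
    (hJ : ∫⁻ x in S, ENNReal.ofReal |J x| = 0) : AreaFormulaOn f J S := by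
  have e : multiplicity f S =ᵐ[volume] 0 := by
    filter_upwards [compl_mem_ae_iff.2 hS] with y hy
    have : {x | x ∈ S ∧ f x = y} = ∅ :=
      eq_empty_of_forall_notMem fun x hx => hy ⟨x, hx.1, hx.2⟩
    simp [multiplicity, this]
  exact ⟨aemeasurable_zero.congr e.symm, by rw [hJ, lintegral_congr_ae e]; simp⟩

lemma multiplicity_eq_indicator (hf : InjOn f S) :
    multiplicity f S = (f '' S).indicator 1 := by
  ext y
  by_cases hy : y ∈ f '' S
  · obtain ⟨x, hx, rfl⟩ := hy
    have : {z | z ∈ S ∧ f z = f x} = {x} := by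
      ext z
      exact ⟨fun hz => hf hz.1 hx hz.2, fun hz => by rw [mem_singleton_iff.1 hz]; exact ⟨hx, rfl⟩⟩
    rw [multiplicity, this, indicator_of_mem (mem_image_of_mem f hx)]
    simp
  · have : {z | z ∈ S ∧ f z = y} = ∅ :=
      eq_empty_of_forall_notMem fun x hx => hy ⟨x, hx.1, hx.2⟩
    rw [multiplicity, this, indicator_of_notMem hy]
    simp

variable {G : EuclideanSpace ℝ (Fin n) → EuclideanSpace ℝ (Fin n) →L[ℝ] EuclideanSpace ℝ (Fin n)}

lemma AreaFormulaOn.of_injOn (hS : MeasurableSet S)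
    (hG : ∀ x ∈ S, HasFDerivWithinAt f (G x) S x) (hf : InjOn f S) :
    AreaFormulaOn f (fun x => (G x).det) S := by
  have hm := measurable_image_of_fderivWithin hS hG hf
  rw [AreaFormulaOn, multiplicity_eq_indicator hf]
  refine ⟨(measurable_one.indicator hm).aemeasurable, ?_⟩
  rw [lintegral_abs_det_fderiv_eq_addHaar_image volume hS hG hf, lintegral_indicator_one hm]

/-- The area formula for a map differentiable relative to a measurable set: where the derivative is
singular the image is null by Sard's theorem, and the remaining part is a countable union of pieces
on which the map is injective. -/
lemma AreaFormulaOn.of_hasFDerivWithinAt (hS : MeasurableSet S) (hGm : Measurable G)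
    (hG : ∀ x ∈ S, HasFDerivWithinAt f (G x) S x) :
    AreaFormulaOn f (fun x => (G x).det) S := by
  have hdet : Measurable fun x => (G x).det := continuous_det.measurable.comp hGm
  have hZ : MeasurableSet {x | (G x).det = 0} := hdet (measurableSet_singleton 0)
  have hSZ := hS.inter hZ
  have hSZ' := hS.diff hZ
  rw [← inter_union_sdiff S {x | (G x).det = 0}]
  refine AreaFormulaOn.union disjoint_sdiff_inter.symm hSZ hSZ' ?_ ?_
  · refine .of_image_null ?_ ?_
    · exact addHaar_image_eq_zero_of_det_fderivWithin_eq_zero volume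
        (fun x hx => (hG x hx.1).mono inter_subset_left) (fun x hx => hx.2)
    · rw [setLIntegral_congr_fun hSZ (g := 0) (fun x hx => by
        have : (G x).det = 0 := hx.2
        simp [this])]
      simp
  · set T := S \ {x | (G x).det = 0}
    have hGT : ∀ x ∈ T, HasFDerivWithinAt f (G x) T x := fun x hx => (hG x hx.1).mono sdiff_subset
    rcases T.eq_empty_or_nonempty with hT | hT
    · rw [hT]
      exact .of_image_null (by simp) (by simp)
    choose r hr0 hr using exists_injOn_of_approximatesLinearOn (E := EuclideanSpace ℝ (Fin n))
    obtain ⟨t, A, htd, htm, htc, hta, htA⟩ :=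
      exists_partition_approximatesLinearOn_of_hasFDerivWithinAt f T G hGT r hr0
    have hTt : T = ⋃ i, T ∩ t i := by rw [← inter_iUnion, inter_eq_left.2 htc]
    rw [hTt]
    refine AreaFormulaOn.iUnion
      (fun i j hij => (htd hij).mono inter_subset_right inter_subset_right)
      (fun i => hSZ'.inter (htm i)) fun i => ?_
    obtain ⟨y, hy, hAy⟩ := htA hT i
    exact .of_injOn (hSZ'.inter (htm i)) (fun x hx => (hGT x hx.1).mono inter_subset_left)
      (hr (A i) (by rw [hAy]; exact hy.2) f _ (hta i))

end Area
/-! ### Sobolev maps -/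

section Sobolev

variable {n : ℕ} {Ω : Set (EuclideanSpace ℝ (Fin n))}

/-- Weak partial derivatives are unique almost everywhere. -/
lemma IsWeakPartial.ae_eq (hΩ : IsOpen Ω) {u g g' : EuclideanSpace ℝ (Fin n) → ℝ} {j : Fin n}
    (h : IsWeakPartial Ω u j g) (h' : IsWeakPartial Ω u j g') :
    g =ᵐ[volume.restrict Ω] g' := by
  rw [Filter.EventuallyEq, ae_restrict_iff' hΩ.measurableSet]
  have hsub := hΩ.ae_eq_zero_of_integral_contDiff_smul_eq_zero (h.2.1.sub h'.2.1)
    fun φ hφ hc hs => ?_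
  · exact hsub.mono fun x hx hxΩ => sub_eq_zero.1 (hx hxΩ)
  have hint : ∀ w : EuclideanSpace ℝ (Fin n) → ℝ, LocallyIntegrableOn w Ω volume →
      IntegrableOn (fun x => φ x * w x) Ω volume := fun w hw => by
    have h1 : IntegrableOn (fun x => φ x * w x) (tsupport φ) volume :=
      (hw.integrableOn_compact_subset hs hc).continuousOn_mul hφ.continuous.continuousOn hc
    refine (h1.integrable_of_forall_notMem_eq_zero fun x hx => ?_).integrableOn
    rw [image_eq_zero_of_notMem_tsupport hx, zero_mul]
  have e := (h.2.2 φ hφ hc hs).trans (h'.2.2 φ hφ hc hs).symm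
  rw [← sub_eq_zero, ← integral_sub (hint g h.2.1) (hint g' h'.2.1)] at e
  rw [← e, setIntegral_eq_integral_of_forall_compl_eq_zero fun x hx => ?_]
  · simp [mul_sub]
  · rw [image_eq_zero_of_notMem_tsupport fun hx' => hx (hs hx')]; simp

lemma MemW1.isWeakPartial {p : ℝ≥0∞} {u : EuclideanSpace ℝ (Fin n) → ℝ} (h : MemW1 Ω p u)
    (j : Fin n) : IsWeakPartial Ω u j (weakPartial Ω u j) := by
  obtain ⟨g, hg, -⟩ := h.2 j
  have hex : ∃ g, IsWeakPartial Ω u j g := ⟨g, hg⟩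
  rw [weakPartial, dif_pos hex]
  exact hex.choose_spec

/-- The chosen representative `weakPartial` inherits integrability from the derivative provided by
the definition of the Sobolev space, by uniqueness. -/
lemma MemW1.memLp_weakPartial (hΩ : IsOpen Ω) {p : ℝ≥0∞} {u : EuclideanSpace ℝ (Fin n) → ℝ}
    (h : MemW1 Ω p u) (j : Fin n) : MemLp (weakPartial Ω u j) p (volume.restrict Ω) := by
  obtain ⟨g, hg, hgp⟩ := h.2 j
  exact hgp.ae_eq (hg.ae_eq hΩ (h.isWeakPartial j))

/-- A determinant with entries in `Lⁿ` is integrable, by Hölder's inequality. -/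
lemma integrable_det_of_memLp {α : Type*} [MeasurableSpace α] {ν : Measure α} (hn : 1 ≤ n)
    {w : Fin n → Fin n → α → ℝ} (hw : ∀ i j, MemLp (w i j) n ν) :
    Integrable (fun x => Matrix.det (Matrix.of fun i j => w i j x)) ν := by
  simp_rw [Matrix.det_apply]
  refine integrable_finsetSum _ fun σ _ => Integrable.smul _ ?_
  have h := MemLp.prod' (s := Finset.univ) (fun i _ => hw (σ i) i)
  rw [Finset.sum_const, Finset.card_univ, Fintype.card_fin, nsmul_eq_mul,
    ENNReal.mul_inv_cancel (by exact_mod_cast (by omega : n ≠ 0)) (ENNReal.natCast_ne_top n),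
    inv_one, memLp_one_iff_integrable] at h
  exact h

/-- The linear map with matrix entries `w i j x`, written as a sum of elementary matrices. -/
noncomputable def matrixField (w : Fin n → Fin n → EuclideanSpace ℝ (Fin n) → ℝ)
    (x : EuclideanSpace ℝ (Fin n)) : EuclideanSpace ℝ (Fin n) →L[ℝ] EuclideanSpace ℝ (Fin n) :=
  ∑ i, ∑ j, w i j x • Matrix.toEuclideanCLM (n := Fin n) (𝕜 := ℝ) (Matrix.single i j 1)

lemma matrixField_eq (w : Fin n → Fin n → EuclideanSpace ℝ (Fin n) → ℝ)
    (x : EuclideanSpace ℝ (Fin n)) :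
    matrixField w x =
      Matrix.toEuclideanCLM (n := Fin n) (𝕜 := ℝ) (Matrix.of fun i j => w i j x) := by
  conv_rhs => rw [Matrix.matrix_eq_sum_single (Matrix.of fun i j => w i j x)]
  simp only [matrixField, map_sum, ← map_smul, Matrix.smul_single, smul_eq_mul, mul_one,
    Matrix.of_apply]

lemma matrixField_apply (w : Fin n → Fin n → EuclideanSpace ℝ (Fin n) → ℝ)
    (x v : EuclideanSpace ℝ (Fin n)) (i : Fin n) :
    matrixField w x v i = ∑ j, w i j x * v j := by
  rw [matrixField_eq, Matrix.ofLp_toEuclideanCLM]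
  rfl

lemma det_matrixField (w : Fin n → Fin n → EuclideanSpace ℝ (Fin n) → ℝ)
    (x : EuclideanSpace ℝ (Fin n)) :
    (matrixField w x).det = Matrix.det (Matrix.of fun i j => w i j x) := by
  rw [matrixField_eq, ContinuousLinearMap.det, Matrix.coe_toEuclideanCLM_eq_toEuclideanLin,
    Matrix.toEuclideanLin, Matrix.toLpLin_eq_toLin, LinearMap.det_toLin]

lemma stronglyMeasurable_matrixField {w : Fin n → Fin n → EuclideanSpace ℝ (Fin n) → ℝ}
    (hw : ∀ i j, StronglyMeasurable (w i j)) : StronglyMeasurable (matrixField w) :=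
  Finset.stronglyMeasurable_fun_sum _ fun i _ => Finset.stronglyMeasurable_fun_sum _ fun j _ =>
    (hw i j).smul_const _

lemma locallyIntegrable_sum_sum_smul_const {F : Type*} [NormedAddCommGroup F] [NormedSpace ℝ F]
    {w : Fin n → Fin n → EuclideanSpace ℝ (Fin n) → ℝ} (hw : ∀ i j, LocallyIntegrable (w i j))
    (c : Fin n → Fin n → F) : LocallyIntegrable fun x => ∑ i, ∑ j, w i j x • c i j := by
  refine locallyIntegrable_finsetSum _ fun i _ => locallyIntegrable_finsetSum _ fun j _ => ?_
  intro x
  obtain ⟨s, hs, hi⟩ := hw i j x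
  exact ⟨s, hs, Integrable.smul_const hi _⟩

lemma locallyIntegrable_matrixField {w : Fin n → Fin n → EuclideanSpace ℝ (Fin n) → ℝ}
    (hw : ∀ i j, LocallyIntegrable (w i j)) : LocallyIntegrable (matrixField w) :=
  locallyIntegrable_sum_sum_smul_const hw _

/-- The matrix of weak partial derivatives of the components is a weak Fréchet derivative. -/
lemma hasWeakFDerivOn_matrixField {f : EuclideanSpace ℝ (Fin n) → EuclideanSpace ℝ (Fin n)}
    {w : Fin n → Fin n → EuclideanSpace ℝ (Fin n) → ℝ}
    (hf : LocallyIntegrable f) (hw : ∀ i j, LocallyIntegrable (w i j))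
    (h : ∀ i j, IsWeakPartial Ω (fun x => f x i) j (w i j)) :
    HasWeakFDerivOn volume Ω f (matrixField w) := by
  intro φ hφ hc hs v
  have hfi : ∀ i, LocallyIntegrable (fun x => f x i) := fun i x =>
    let ⟨s, hs, hi⟩ := hf x
    ⟨s, hs, hi.eval_piLp i⟩
  have hφ' : ∀ u : EuclideanSpace ℝ (Fin n), Continuous fun x => fderiv ℝ φ x u := fun u =>
    (hφ.continuous_fderiv (by simp)).clm_apply continuous_const
  have hc' : ∀ u : EuclideanSpace ℝ (Fin n), HasCompactSupport fun x => fderiv ℝ φ x u := fun u =>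
    hc.fderiv_apply ℝ u
  have i1 : ∀ i j, Integrable (fun x => φ x * w i j x) := fun i j =>
    (hw i j).integrable_smul_left_of_hasCompactSupport hφ.continuous hc
  have i2 : ∀ i u, Integrable (fun x => fderiv ℝ φ x u * f x i) := fun i u =>
    (hfi i).integrable_smul_left_of_hasCompactSupport (hφ' u) (hc' u)
  have e1 : ∀ i x, (φ x • matrixField w x v) i = ∑ j, v j * (φ x * w i j x) := fun i x => by
    rw [PiLp.smul_apply, matrixField_apply, smul_eq_mul, Finset.mul_sum]
    exact Finset.sum_congr rfl fun j _ => by ring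
  have e2 : ∀ i x, (fderiv ℝ φ x v • f x) i =
      ∑ j, v j * (fderiv ℝ φ x (EuclideanSpace.single j (1 : ℝ)) * f x i) := fun i x => by
    have hv : v = ∑ j, v j • EuclideanSpace.single j (1 : ℝ) := by
      simpa using ((EuclideanSpace.basisFun (Fin n) ℝ).sum_repr v).symm
    rw [PiLp.smul_apply, smul_eq_mul]
    conv_lhs => rw [hv, map_sum]
    rw [Finset.sum_mul]
    exact Finset.sum_congr rfl fun j _ => by rw [map_smul, smul_eq_mul, mul_assoc]
  have whole : ∀ i j, ∫ x, φ x * w i j x =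
      - ∫ x, fderiv ℝ φ x (EuclideanSpace.single j (1 : ℝ)) * f x i := fun i j => by
    have := (h i j).2.2 φ hφ hc hs
    rwa [setIntegral_eq_integral_of_forall_compl_eq_zero fun x hx => ?_,
      setIntegral_eq_integral_of_forall_compl_eq_zero fun x hx => ?_] at this
    · rw [fderiv_of_notMem_tsupport (𝕜 := ℝ) fun hx' => hx (hs hx')]; simp
    · rw [image_eq_zero_of_notMem_tsupport fun hx' => hx (hs hx'), zero_mul]
  ext i
  rw [PiLp.neg_apply, eval_integral_piLp fun i => ?_, eval_integral_piLp fun i => ?_]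
  · simp_rw [e1, e2]
    rw [integral_finsetSum _ fun j _ => (i1 i j).const_mul _,
      integral_finsetSum _ fun j _ => (i2 i _).const_mul _, ← Finset.sum_neg_distrib]
    refine Finset.sum_congr rfl fun j _ => ?_
    rw [integral_const_mul, integral_const_mul, whole, mul_neg]
  · exact (i2 i v).congr (by simp)
  · simp_rw [e1]
    exact integrable_finsetSum _ fun j _ => (i1 i j).const_mul _

lemma IsWeakPartial.congr {u u' g g' : EuclideanSpace ℝ (Fin n) → ℝ} {j : Fin n}
    (h : IsWeakPartial Ω u j g) (hu : u =ᵐ[volume.restrict Ω] u')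
    (hg : g =ᵐ[volume.restrict Ω] g') : IsWeakPartial Ω u' j g' := by
  refine ⟨?_, ?_, fun φ h1 h2 h3 => ?_⟩
  · refine fun x hx => ?_
    obtain ⟨s, hs, hi⟩ := h.1 x hx
    refine ⟨s ∩ Ω, inter_mem hs self_mem_nhdsWithin, ?_⟩
    exact (hi.mono_set inter_subset_left).congr_fun_ae
      (ae_restrict_of_ae_restrict_of_subset inter_subset_right hu)
  · refine fun x hx => ?_
    obtain ⟨s, hs, hi⟩ := h.2.1 x hx
    refine ⟨s ∩ Ω, inter_mem hs self_mem_nhdsWithin, ?_⟩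
    exact (hi.mono_set inter_subset_left).congr_fun_ae
      (ae_restrict_of_ae_restrict_of_subset inter_subset_right hg)
  · have e1 : ∫ x in Ω, φ x * g' x = ∫ x in Ω, φ x * g x :=
      integral_congr_ae (hg.mono fun x hx => by simp only [hx])
    have e2 : ∫ x in Ω, fderiv ℝ φ x (EuclideanSpace.single j (1 : ℝ)) * u' x =
        ∫ x in Ω, fderiv ℝ φ x (EuclideanSpace.single j (1 : ℝ)) * u x :=
      integral_congr_ae (hu.mono fun x hx => by simp only [hx])
    rw [e1, e2]
    exact h.2.2 φ h1 h2 h3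

/-- The area formula for a Sobolev map with property (N). -/
theorem areaFormulaOn_of_memW1Vec (hn : 1 ≤ n) (hΩ : IsOpen Ω)
    {f : EuclideanSpace ℝ (Fin n) → EuclideanSpace ℝ (Fin n)} (hf : MemW1Vec Ω n f)
    (hN : PropertyN Ω f) : AreaFormulaOn f (jacobian Ω f) Ω := by
  have hΩm := hΩ.measurableSet
  have hn1 : (1 : ℝ≥0∞) ≤ n := by exact_mod_cast hn
  have hw0 : ∀ i j, MemLp (weakPartial Ω (fun z => f z i) j) n (volume.restrict Ω) := fun i j =>
    (hf i).memLp_weakPartial hΩ j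
  -- Representatives of the derivatives that are measurable and vanish off `Ω`; extension by zero
  -- turns integrability on `Ω` into local integrability on the whole space.
  set w : Fin n → Fin n → EuclideanSpace ℝ (Fin n) → ℝ := fun i j =>
    Ω.indicator ((hw0 i j).1.mk _)
  have hwae : ∀ i j, weakPartial Ω (fun z => f z i) j =ᵐ[volume.restrict Ω] w i j := fun i j =>
    (hw0 i j).1.ae_eq_mk.trans (indicator_ae_eq_restrict hΩm).symm
  have hwm : ∀ i j, StronglyMeasurable (w i j) := fun i j =>
    (hw0 i j).1.stronglyMeasurable_mk.indicator hΩm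
  have hwl : ∀ i j, LocallyIntegrable (w i j) := fun i j =>
    ((memLp_indicator_iff_restrict hΩm).2 ((hw0 i j).ae_eq (hw0 i j).1.ae_eq_mk)).locallyIntegrable
      hn1
  set f₀ := Ω.indicator f
  have hfp : MemLp f n (volume.restrict Ω) := MemLp.of_eval_piLp fun i => (hf i).1
  have hf₀p : MemLp f₀ n volume := (memLp_indicator_iff_restrict hΩm).2 hfp
  have hf₀ : LocallyIntegrable f₀ := hf₀p.locallyIntegrable hn1
  have hff₀ : EqOn f f₀ Ω := fun x hx => (indicator_of_mem hx f).symm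
  have hweak : HasWeakFDerivOn volume Ω f₀ (matrixField w) :=
    hasWeakFDerivOn_matrixField hf₀ hwl fun i j => ((hf i).isWeakPartial j).congr
      ((ae_restrict_iff' hΩm).2 (Eventually.of_forall fun x hx => by simp only [hff₀ hx]))
      (hwae i j)
  have hGm := stronglyMeasurable_matrixField hwm
  obtain ⟨A, hAm, hAΩ, hA0, hA⟩ := hweak.exists_seq_hasFDerivWithinAt hΩ hf₀
    (locallyIntegrable_matrixField hwl) hGm
  set B : ℕ → Set (EuclideanSpace ℝ (Fin n)) := disjointed fun k => A k.unpair
  have hBA : ∀ k, B k ⊆ A k.unpair := disjointed_subset _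
  have hBm : ∀ k, MeasurableSet (B k) := MeasurableSet.disjointed fun k => hAm _
  have hBU : ⋃ k, B k = ⋃ i, A i := by
    rw [iUnion_disjointed]; exact Nat.surjective_unpair.iUnion_comp A
  have hUΩ : ⋃ k, B k ⊆ Ω := iUnion_subset fun k => (hBA k).trans (hAΩ _)
  rw [← hBU] at hA0
  have hUm : MeasurableSet (⋃ k, B k) := .iUnion hBm
  have key : AreaFormulaOn f (fun x => (matrixField w x).det) Ω := by
    rw [← union_sdiff_cancel hUΩ]
    refine AreaFormulaOn.union disjoint_sdiff_right hUm (hΩm.diff hUm) ?_ ?_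
    · refine AreaFormulaOn.iUnion (disjoint_disjointed _) hBm fun k => ?_
      refine .of_hasFDerivWithinAt (hBm k) hGm.measurable fun x hx => ?_
      exact ((hA _ x (hBA k hx)).mono (hBA k)).congr
        (fun y hy => hff₀ (hAΩ _ (hBA k hy))) (hff₀ (hAΩ _ (hBA k hx)))
    · exact .of_image_null (hN _ sdiff_subset hA0) (setLIntegral_measure_zero _ _ hA0)
  refine ⟨key.1, (lintegral_congr_ae ?_).trans key.2⟩
  have hall : ∀ᵐ x ∂volume.restrict Ω, ∀ i j, weakPartial Ω (fun z => f z i) j x = w i j x :=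
    ae_all_iff.2 fun i => ae_all_iff.2 fun j => hwae i j
  filter_upwards [hall] with x hx
  rw [det_matrixField, jacobian]
  simp_rw [hx]

end Sobolev

end SobolevArea

theorem mainTheorem12 (n : ℕ) (hn : 1 ≤ n)
    (Ω : Set (EuclideanSpace ℝ (Fin n))) (hΩ : IsOpen Ω) (hΩne : Ω.Nonempty)
    (f : EuclideanSpace ℝ (Fin n) → EuclideanSpace ℝ (Fin n))
    (hf : SobolevArea.MemW1Vec Ω (n : ℝ≥0∞) f)
    (hN : SobolevArea.PropertyN Ω f) :
    IntegrableOn (SobolevArea.jacobian Ω f) Ω volume ∧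
    AEMeasurable (fun y => SobolevArea.multiplicity f Ω y) volume ∧
    ∫⁻ x in Ω, ENNReal.ofReal |SobolevArea.jacobian Ω f x| =
      ∫⁻ y, SobolevArea.multiplicity f Ω y :=
  ⟨SobolevArea.integrable_det_of_memLp hn fun i j => (hf i).memLp_weakPartial hΩ j,
    SobolevArea.areaFormulaOn_of_memW1Vec hn hΩ hf hN⟩
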